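/- **Setting.** Let $\mathcal T$ be a finite conforming mesh of nondegenerate tetrahedra in $\mathbb R^3$ (two tetrahedra meet exactly in the convex hull of their common vertices), let $\Omega$ be the interior of their union, and let the boundary triangles (those lying in exactly one tetrahedron) be split into two sets $\Gamma_i$ and $\Gamma_o$. Let $\varepsilon,\mu$ be positive continuous functions on $\Omega$ with $\varepsilon$ and $\mu^{-1}$ integrable, let $\tau>0$ and $1+\gamma\ge 0$. Write $(\cdot,\cdot)$ for the $L^2(\Omega)$ inner product, $\|u\|_{w}^2=(wu,u)$, and $u_{\rm tan}$ for the tangential part of $u$ on a boundary triangle. For a fixed order $r\ge 0$ let * $H_{h,\rm imp}({\rm div})$ be the Raviart–Thomas space of order $r$ (elementwise in $P_r^3+xP_r$, normal component continuous across faces) with $\vec B\cdot \vec n=0$ on $\Gamma_o$; * $H_{h,\rm imp}({\rm curl})$ be the Nédélec space of the first kind of order $r$ (elementwise in $P_r^3+x\times P_r^3$, tangential component continuous across faces) with $\vec E\wedge \vec n=0$ on $\Gamma_o$; * $H_{h,0}({\rm grad})$ be the space of continuous piecewise polynomials of degree at most $r+1$ that vanish on $\partial\Omega$; * $H^0_{h,\rm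 imp}({\rm div})=\{\vec B\in H_{h,\rm imp}({\rm div}):{\rm div}\,\vec B=0\}$ and $V_h=H_{h,\rm imp}({\rm div})\times H_{h,\rm imp}({\rm curl})\times H_{h,0}({\rm grad})$. On $V_h$ use the norm $$\|(\vec B,\vec E,p)\|^2=\tfrac2\tau\|\vec B\|_{\mu^{-1}}^2+\|{\rm div}\,\vec B\|^2+\tfrac2\tau\|\vec E\|_\varepsilon^2+\tfrac\tau2\|{\rm curl}\,\vec E\|_{\mu^{-1}}^2+(1+\gamma)\int_{\Gamma_i}|\vec E_{\rm tan}|^2+\tfrac2\tau\|p\|^2+\tfrac\tau2\|{\rm grad}\,p\|_\varepsilon^2 ,$$ and for a functional $g=(g_{\vec B},g_{\vec E},g_p)$ on $V_h$ let $\|g\|_{*}$ be the dual norm. **Theorem.** Let $g_{\vec B},g_{\vec E},g_p$ be linear functionals on $H_{h,\rm imp}({\rm div})$, $H_{h,\rm imp}({\rm curl})$, $H_{h,0}({\rm grad})$, and suppose $g_{\vec B}\in\big(H^0_{h,\rm imp}({\rm div})\big)'$, that is, $g_{\vec B}(\vec C)=0$ for every $\vec C\in H_{h,\rm imp}({\rm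 div})$ with $(\mu^{-1}\vec C,\vec D)=0$ for all $\vec D\in H^0_{h,\rm imp}({\rm div})$ (equivalently, $g_{\vec B}=(\mu^{-1}\vec B_0,\cdot)$ for some $\vec B_0\in H^0_{h,\rm imp}({\rm div})$). Then the discrete mixed problem $$\tfrac2\tau(\mu^{-1}\vec B,\vec C)+(\mu^{-1}{\rm curl}\,\vec E,\vec C)=g_{\vec B}(\vec C),$$ $$\tfrac2\tau(\varepsilon\vec E,\vec F)+(\varepsilon\,{\rm grad}\,p,\vec F)-(\mu^{-1}\vec B,{\rm curl}\,\vec F)+(1+\gamma)\int_{\Gamma_i}\langle\vec E_{\rm tan},\vec F_{\rm tan}\rangle=g_{\vec E}(\vec F),$$ $$\tfrac2\tau(p,q)-(\varepsilon\vec E,{\rm grad}\,q)=g_p(q)\qquad\text{for all }(\vec C,\vec F,q)\in V_h$$ is well-posed: it has exactly one solution $(\vec B,\vec E,p)\in V_h$; this solution satisfies ${\rm div}\,\vec B=0$, and $$\|(\vec B,\vec E,p)\|\le 4\,\|g\|_{*},\qquad \|g\|_{*}\le 3\,\|(\vec B,\vec E,p)\|,$$ so the constants do not depend on the mesh, $r$,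 $\tau$, $\gamma$, $\varepsilon$ or $\mu$. -/

import Mathlib

open MeasureTheory
open scoped RealInnerProductSpace

namespace MaxwellFEM

/-- Euclidean three-space. -/
abbrev E3 : Type := EuclideanSpace ℝ (Fin 3)

/-- Real polynomials in the three space variables. -/
abbrev Poly : Type := MvPolynomial (Fin 3) ℝ

/-- Polynomial vector fields on three-space. -/
abbrev VecPoly : Type := Fin 3 → Poly

/-! ### Meshes -/

/-- A finite conforming tetrahedral mesh. A cell is the set of the four vertices of a
nondegenerate tetrahedron (its convex hull); two tetrahedra meet exactly in the convex hull of their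
common vertices, i.e. in nothing, a common vertex, a common edge, a common face, or they coincide.
The set `gammaI` lists the boundary triangles (triangles lying in exactly one tetrahedron) that
make up the impedance part `Γ_i` of the boundary; the other boundary triangles make up `Γ_o`. -/
structure Mesh where
  cells : Finset (Finset E3)
  card_eq : ∀ K ∈ cells, K.card = 4
  nondegenerate : ∀ K ∈ cells, AffineIndependent ℝ (fun x : K => (x : E3))
  conforming : ∀ K ∈ cells, ∀ L ∈ cells,
    convexHull ℝ (K : Set E3) ∩ convexHull ℝ (L : Set E3) =
      convexHull ℝ ((K : Set E3) ∩ (L : Set E3))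
  gammaI : Finset (Finset E3)
  gammaI_boundary : ∀ F ∈ gammaI, F.card = 3 ∧ ∃! K, K ∈ cells ∧ F ⊆ K

/-- A boundary triangle: a face of exactly one tetrahedron. -/
def Mesh.IsBoundaryFace (T : Mesh) (F : Finset E3) : Prop :=
  F.card = 3 ∧ ∃! K, K ∈ T.cells ∧ F ⊆ K

/-- A triangle of `Γ_o`. -/
def Mesh.IsOuterFace (T : Mesh) (F : Finset E3) : Prop :=
  T.IsBoundaryFace F ∧ F ∉ T.gammaI

/-- The closed simplex spanned by a finite set of vertices. -/
def simplex (K : Finset E3) : Set E3 := convexHull ℝ (K : Set E3)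

/-- The open polyhedral domain `Ω` covered by the mesh. -/
def Mesh.domain (T : Mesh) : Set E3 := interior (⋃ K ∈ T.cells, simplex K)

/-! ### Polynomial fields and differential operators -/

/-- Value of a polynomial at a point. -/
noncomputable def evalS (p : Poly) (x : E3) : ℝ := MvPolynomial.eval (fun i => x i) p

/-- Value of a polynomial vector field at a point. -/
noncomputable def evalV (v : VecPoly) (x : E3) : E3 := WithLp.toLp 2 (fun i => evalS (v i) x)

noncomputable def gradP (p : Poly) : VecPoly := fun i => MvPolynomial.pderiv i p

noncomputable def curlP (v : VecPoly) : VecPoly :=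
  ![MvPolynomial.pderiv 1 (v 2) - MvPolynomial.pderiv 2 (v 1),
    MvPolynomial.pderiv 2 (v 0) - MvPolynomial.pderiv 0 (v 2),
    MvPolynomial.pderiv 0 (v 1) - MvPolynomial.pderiv 1 (v 0)]

noncomputable def divP (v : VecPoly) : Poly := ∑ i, MvPolynomial.pderiv i (v i)

/-- Tangential part `v - ⟨v, n⟩ n` of a vector on a triangle `F` with unit normal `n`: the
orthogonal projection of `v` onto the plane of directions of `F`. -/
noncomputable def tanPart (F : Finset E3) (v : E3) : E3 :=
  (vectorSpan ℝ (F : Set E3)).starProjection v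

/-- Normal part `⟨v, n⟩ n` of a vector on a triangle `F` with unit normal `n`. -/
noncomputable def normalPart (F : Finset E3) (v : E3) : E3 := v - tanPart F v

/-! ### Finite element spaces

A piecewise polynomial function on the mesh is a family of polynomials, one for each tetrahedron.
The conforming spaces are cut out by the usual interelement conditions, under which the
elementwise gradient, curl and divergence are the weak ones on `Ω`. -/

lemma evalS_add (p q : Poly) (x : E3) : evalS (p + q) x = evalS p x + evalS q x := by
  simp [evalS]

lemma evalS_smul (c : ℝ) (p : Poly) (x : E3) : evalS (c • p) x = c * evalS p x := by
  simp [evalS, MvPolynomial.smul_eval]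

lemma evalS_zero (x : E3) : evalS 0 x = 0 := by simp [evalS]

lemma evalV_add (u v : VecPoly) (x : E3) : evalV (u + v) x = evalV u x + evalV v x := by
  ext i; simp [evalV, evalS_add]

lemma evalV_smul (c : ℝ) (v : VecPoly) (x : E3) : evalV (c • v) x = c • evalV v x := by
  ext i; simp [evalV, evalS_smul]

lemma evalV_zero (x : E3) : evalV 0 x = 0 := by
  ext i; simp [evalV, evalS_zero]

lemma tanPart_add (F : Finset E3) (u v : E3) : tanPart F (u + v) = tanPart F u + tanPart F v := by
  simp [tanPart]

lemma tanPart_smul (F : Finset E3) (c : ℝ) (v : E3) : tanPart F (c • v) = c • tanPart F v := by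
  simp [tanPart]

lemma tanPart_zero (F : Finset E3) : tanPart F 0 = 0 := by simp [tanPart]

lemma normalPart_add (F : Finset E3) (u v : E3) :
    normalPart F (u + v) = normalPart F u + normalPart F v := by
  simp only [normalPart, tanPart_add]; abel

lemma normalPart_smul (F : Finset E3) (c : ℝ) (v : E3) :
    normalPart F (c • v) = c • normalPart F v := by
  simp only [normalPart, tanPart_smul, smul_sub]

lemma normalPart_zero (F : Finset E3) : normalPart F 0 = 0 := by
  simp [normalPart, tanPart_zero]

/-- Polynomials of total degree at most `r`. -/
noncomputable def polyDeg (r : ℕ) : Submodule ℝ Poly :=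
  MvPolynomial.restrictTotalDegree (Fin 3) ℝ r

/-- The local Raviart–Thomas space `P_r³ + x P_r` (`r = 0` is the lowest order). -/
noncomputable def localRT (r : ℕ) : Submodule ℝ VecPoly where
  carrier := {v | ∃ a : VecPoly, ∃ b : Poly, (∀ i, a i ∈ polyDeg r) ∧ b ∈ polyDeg r ∧
    v = fun i => a i + MvPolynomial.X i * b}
  zero_mem' := ⟨0, 0, fun _ => zero_mem _, zero_mem _, by ext1 i; simp⟩
  add_mem' := by
    rintro _ _ ⟨a, b, ha, hb, rfl⟩ ⟨a', b', ha', hb', rfl⟩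
    refine ⟨a + a', b + b', fun i => add_mem (ha i) (ha' i), add_mem hb hb', ?_⟩
    ext1 i
    simp only [Pi.add_apply]
    ring
  smul_mem' := by
    rintro c _ ⟨a, b, ha, hb, rfl⟩
    refine ⟨c • a, c • b, fun i => Submodule.smul_mem _ c (ha i), Submodule.smul_mem _ c hb, ?_⟩
    ext1 i
    simp only [Pi.smul_apply, smul_add, mul_smul_comm]

/-- The local Nédélec space of the first kind `P_r³ + x × P_r³` (`r = 0` is the lowest order). -/
noncomputable def localNedelec (r : ℕ) : Submodule ℝ VecPoly where
  carrier := {v | ∃ a b : VecPoly, (∀ i, a i ∈ polyDeg r) ∧ (∀ i, b i ∈ polyDeg r) ∧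
    v = a + crossProduct (fun i => (MvPolynomial.X i : Poly)) b}
  zero_mem' := ⟨0, 0, fun _ => zero_mem _, fun _ => zero_mem _, by simp⟩
  add_mem' := by
    rintro _ _ ⟨a, b, ha, hb, rfl⟩ ⟨a', b', ha', hb', rfl⟩
    refine ⟨a + a', b + b', fun i => add_mem (ha i) (ha' i), fun i => add_mem (hb i) (hb' i), ?_⟩
    rw [map_add]
    abel
  smul_mem' := by
    rintro c _ ⟨a, b, ha, hb, rfl⟩
    refine ⟨c • a, c • b, fun i => Submodule.smul_mem _ c (ha i),
      fun i => Submodule.smul_mem _ c (hb i), ?_⟩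
    have hX : crossProduct (fun i => (MvPolynomial.X i : Poly)) (c • b) =
        c • crossProduct (fun i => (MvPolynomial.X i : Poly)) b := by
      ext1 i
      fin_cases i <;> simp [crossProduct, smul_sub]
    rw [hX, smul_add]

/-- The Raviart–Thomas space `H_{h,imp}(div)`: elementwise in the local space, normal component
continuous across interior faces and zero on `Γ_o`. -/
noncomputable def raviartThomas (T : Mesh) (r : ℕ) : Submodule ℝ (T.cells → VecPoly) where
  carrier := {v | (∀ K, v K ∈ localRT r) ∧
    (∀ (K L : T.cells) (F : Finset E3), F.card = 3 → F ⊆ K.1 → F ⊆ L.1 → ∀ x ∈ simplex F,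
      normalPart F (evalV (v K) x) = normalPart F (evalV (v L) x)) ∧
    (∀ (K : T.cells) (F : Finset E3), T.IsOuterFace F → F ⊆ K.1 → ∀ x ∈ simplex F,
      normalPart F (evalV (v K) x) = 0)}
  zero_mem' := by simp [evalV_zero, normalPart_zero]
  add_mem' := by
    rintro u v ⟨hu, hu', hu''⟩ ⟨hv, hv', hv''⟩
    refine ⟨fun K => add_mem (hu K) (hv K), fun K L F h3 hK hL x hx => ?_,
      fun K F hF hK x hx => ?_⟩
    · simp only [Pi.add_apply, evalV_add, normalPart_add, hu' K L F h3 hK hL x hx,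
        hv' K L F h3 hK hL x hx]
    · simp only [Pi.add_apply, evalV_add, normalPart_add, hu'' K F hF hK x hx,
        hv'' K F hF hK x hx, add_zero]
  smul_mem' := by
    rintro c v ⟨hv, hv', hv''⟩
    refine ⟨fun K => Submodule.smul_mem _ c (hv K), fun K L F h3 hK hL x hx => ?_,
      fun K F hF hK x hx => ?_⟩
    · simp only [Pi.smul_apply, evalV_smul, normalPart_smul, hv' K L F h3 hK hL x hx]
    · simp only [Pi.smul_apply, evalV_smul, normalPart_smul, hv'' K F hF hK x hx, smul_zero]

/-- The Nédélec space `H_{h,imp}(curl)`: elementwise in the local space, tangential component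
continuous across interior faces and zero on `Γ_o`. -/
noncomputable def nedelec (T : Mesh) (r : ℕ) : Submodule ℝ (T.cells → VecPoly) where
  carrier := {v | (∀ K, v K ∈ localNedelec r) ∧
    (∀ (K L : T.cells) (F : Finset E3), F.card = 3 → F ⊆ K.1 → F ⊆ L.1 → ∀ x ∈ simplex F,
      tanPart F (evalV (v K) x) = tanPart F (evalV (v L) x)) ∧
    (∀ (K : T.cells) (F : Finset E3), T.IsOuterFace F → F ⊆ K.1 → ∀ x ∈ simplex F,
      tanPart F (evalV (v K) x) = 0)}
  zero_mem' := by simp [evalV_zero, tanPart_zero]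
  add_mem' := by
    rintro u v ⟨hu, hu', hu''⟩ ⟨hv, hv', hv''⟩
    refine ⟨fun K => add_mem (hu K) (hv K), fun K L F h3 hK hL x hx => ?_,
      fun K F hF hK x hx => ?_⟩
    · simp only [Pi.add_apply, evalV_add, tanPart_add, hu' K L F h3 hK hL x hx,
        hv' K L F h3 hK hL x hx]
    · simp only [Pi.add_apply, evalV_add, tanPart_add, hu'' K F hF hK x hx,
        hv'' K F hF hK x hx, add_zero]
  smul_mem' := by
    rintro c v ⟨hv, hv', hv''⟩
    refine ⟨fun K => Submodule.smul_mem _ c (hv K), fun K L F h3 hK hL x hx => ?_,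
      fun K F hF hK x hx => ?_⟩
    · simp only [Pi.smul_apply, evalV_smul, tanPart_smul, hv' K L F h3 hK hL x hx]
    · simp only [Pi.smul_apply, evalV_smul, tanPart_smul, hv'' K F hF hK x hx, smul_zero]

/-- The Lagrange space `H_{h,0}(grad)`: continuous, elementwise of degree at most `r + 1`, zero on
the whole boundary. -/
noncomputable def lagrange (T : Mesh) (r : ℕ) : Submodule ℝ (T.cells → Poly) where
  carrier := {p | (∀ K, p K ∈ polyDeg (r + 1)) ∧
    (∀ (K L : T.cells), ∀ x ∈ simplex K.1 ∩ simplex L.1, evalS (p K) x = evalS (p L) x) ∧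
    (∀ (K : T.cells) (F : Finset E3), T.IsBoundaryFace F → F ⊆ K.1 → ∀ x ∈ simplex F,
      evalS (p K) x = 0)}
  zero_mem' := by simp [evalS_zero]
  add_mem' := by
    rintro u v ⟨hu, hu', hu''⟩ ⟨hv, hv', hv''⟩
    refine ⟨fun K => add_mem (hu K) (hv K), fun K L x hx => ?_, fun K F hF hK x hx => ?_⟩
    · simp only [Pi.add_apply, evalS_add, hu' K L x hx, hv' K L x hx]
    · simp only [Pi.add_apply, evalS_add, hu'' K F hF hK x hx, hv'' K F hF hK x hx, add_zero]
  smul_mem' := by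
    rintro c v ⟨hv, hv', hv''⟩
    refine ⟨fun K => Submodule.smul_mem _ c (hv K), fun K L x hx => ?_,
      fun K F hF hK x hx => ?_⟩
    · simp only [Pi.smul_apply, evalS_smul, hv' K L x hx]
    · simp only [Pi.smul_apply, evalS_smul, hv'' K F hF hK x hx, mul_zero]

/-- The product space `V_h = H_{h,imp}(div) × H_{h,imp}(curl) × H_{h,0}(grad)`. -/
abbrev Vh (T : Mesh) (r : ℕ) : Type := raviartThomas T r × nedelec T r × lagrange T r

/-! ### Inner products -/

/-- Elementwise gradient, curl and divergence. -/
noncomputable def gradh {T : Mesh} (p : T.cells → Poly) : T.cells → VecPoly := fun K => gradP (p K)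

noncomputable def curlh {T : Mesh} (v : T.cells → VecPoly) : T.cells → VecPoly :=
  fun K => curlP (v K)

noncomputable def divh {T : Mesh} (v : T.cells → VecPoly) : T.cells → Poly := fun K => divP (v K)

/-- The `L²(Ω)` inner product `(p, q)` of piecewise polynomial scalar functions. -/
noncomputable def innerS {T : Mesh} (p q : T.cells → Poly) : ℝ :=
  ∑ K : T.cells, ∫ x in simplex K.1, evalS (p K) x * evalS (q K) x

/-- The weighted `L²(Ω)` inner product `(w u, v)` of piecewise polynomial vector fields. -/
noncomputable def innerV {T : Mesh} (w : E3 → ℝ) (u v : T.cells → VecPoly) : ℝ :=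
  ∑ K : T.cells, ∫ x in simplex K.1, w x * ⟪evalV (u K) x, evalV (v K) x⟫

open Classical in
/-- The surface integral of `⟨u_tan, v_tan⟩` over `Γ_i`, with traces taken from the unique
tetrahedron containing each boundary triangle. The surface measure is the two-dimensional Hausdorff
measure, normalized to be the area. -/
noncomputable def innerGamma {T : Mesh} (u v : T.cells → VecPoly) : ℝ :=
  ∑ F ∈ T.gammaI, ∑ K : T.cells with F ⊆ K.1,
    ∫ x in simplex F, ⟪tanPart F (evalV (u K) x), tanPart F (evalV (v K) x)⟫ ∂μHE[2]

/-! ### The discrete mixed problem -/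

/-- `‖B‖_div² = (2/τ) ‖B‖²_{μ⁻¹} + ‖div B‖²`. -/
noncomputable def normDivSq {T : Mesh} (τ : ℝ) (μ : E3 → ℝ) (B : T.cells → VecPoly) : ℝ :=
  2 / τ * innerV (fun x => (μ x)⁻¹) B B + innerS (divh B) (divh B)

/-- `‖E‖_curl² = (2/τ) ‖E‖²_ε + (τ/2) ‖curl E‖²_{μ⁻¹} + (1 + γ) ‖E_tan‖²_{Γ_i}`. -/
noncomputable def normCurlSq {T : Mesh} (τ γ : ℝ) (ε μ : E3 → ℝ) (E : T.cells → VecPoly) : ℝ :=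
  2 / τ * innerV ε E E + τ / 2 * innerV (fun x => (μ x)⁻¹) (curlh E) (curlh E)
    + (1 + γ) * innerGamma E E

/-- `‖p‖_grad² = (2/τ) ‖p‖² + (τ/2) ‖grad p‖²_ε`. -/
noncomputable def normGradSq {T : Mesh} (τ : ℝ) (ε : E3 → ℝ) (p : T.cells → Poly) : ℝ :=
  2 / τ * innerS p p + τ / 2 * innerV ε (gradh p) (gradh p)

/-- The weighted norm `(‖B‖_div² + ‖E‖_curl² + ‖p‖_grad²)^{1/2}` on `V_h`. -/
noncomputable def normVh {T : Mesh} {r : ℕ} (τ γ : ℝ) (ε μ : E3 → ℝ) (x : Vh T r) : ℝ :=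
  √(normDivSq τ μ x.1.1 + normCurlSq τ γ ε μ x.2.1.1 + normGradSq τ ε x.2.2.1)

/-- The dual norm, with respect to `normVh`, of the functional
`(C, F, q) ↦ gB C + gE F + gp q` on `V_h`. -/
noncomputable def dualNorm {T : Mesh} {r : ℕ} (τ γ : ℝ) (ε μ : E3 → ℝ)
    (gB : raviartThomas T r →ₗ[ℝ] ℝ) (gE : nedelec T r →ₗ[ℝ] ℝ) (gp : lagrange T r →ₗ[ℝ] ℝ) : ℝ :=
  sInf {M : ℝ | 0 ≤ M ∧ ∀ y : Vh T r, |gB y.1 + gE y.2.1 + gp y.2.2| ≤ M * normVh τ γ ε μ y}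

/-- `x = (B, E, p)` solves the discrete mixed problem with right-hand side `(gB, gE, gp)`. -/
def IsSolution {T : Mesh} {r : ℕ} (τ γ : ℝ) (ε μ : E3 → ℝ)
    (gB : raviartThomas T r →ₗ[ℝ] ℝ) (gE : nedelec T r →ₗ[ℝ] ℝ) (gp : lagrange T r →ₗ[ℝ] ℝ)
    (x : Vh T r) : Prop :=
  (∀ C : raviartThomas T r,
    2 / τ * innerV (fun x => (μ x)⁻¹) x.1.1 C.1
      + innerV (fun x => (μ x)⁻¹) (curlh x.2.1.1) C.1 = gB C) ∧
  (∀ F : nedelec T r,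
    2 / τ * innerV ε x.2.1.1 F.1 + innerV ε (gradh x.2.2.1) F.1
      - innerV (fun x => (μ x)⁻¹) x.1.1 (curlh F.1)
      + (1 + γ) * innerGamma x.2.1.1 F.1 = gE F) ∧
  (∀ q : lagrange T r,
    2 / τ * innerS x.2.2.1 q.1 - innerV ε x.2.1.1 (gradh q.1) = gp q)

/-- `gB ∈ (H⁰_{h,imp}(div))'`, where `H⁰_{h,imp}(div)` is the space of divergence-free
Raviart–Thomas fields and its dual is the space of functionals on `H_{h,imp}(div)` that vanish on
the `(μ⁻¹ ·, ·)`-orthogonal complement of `H⁰_{h,imp}(div)`. These are the functionals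
`C ↦ (μ⁻¹ B₀, C)` with `B₀` divergence-free. -/
def InDivFreeDual {T : Mesh} {r : ℕ} (μ : E3 → ℝ) (gB : raviartThomas T r →ₗ[ℝ] ℝ) : Prop :=
  ∀ C : raviartThomas T r,
    (∀ D : raviartThomas T r, divh D.1 = 0 → innerV (fun x => (μ x)⁻¹) C.1 D.1 = 0) → gB C = 0

end MaxwellFEM

/-! Write `a(x, y)` for the sum of the three left-hand sides, with `x = (B, E, p)` and `y = (C, F,
q)`. The couplings through curl and grad enter skew-symmetrically, so they cancel in `a(x, x)`,
leaving the weighted `L²` norms and a nonnegative boundary term. Hence the operator is injective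
(`mixedOperator_injective`) and, the system being square and finite-dimensional, bijective.

The rest uses only a discrete complex: `grad` maps the Lagrange space into the Nédélec space, `curl`
maps that into the Raviart–Thomas space, `curl grad = 0`, `div curl = 0`, and gradients have no
tangential trace on the boundary. Since `curl E` is divergence-free, testing the first equation with
the part of `B` orthogonal to the divergence-free fields gives `div B = 0`
(`mixedOperator_div_eq_zero`).

Stability (`mixedNormSq_le`) comes from the test triple `y = (B + (τ/2) curl E, E + (τ/2) grad p,
p)`, which recovers the curl and gradient parts of the norm: `‖x‖² ≤ 2 a(x, y)` and `‖y‖² ≤ 3 ‖x‖²`.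
The reverse bound is continuity of `a` (`abs_mixedForm_le`). Both follow from Young's inequality
with weights `2/τ` and `τ/2`, exactly those of the norm, so no parameter enters the constants.

The geometric work is in the traces: `normalPart_curlP_eq_zero` and `tanPart_gradP_eq_zero` show
that curl and grad preserve the interelement and boundary conditions. -/

namespace MaxwellFEM

/-! ### Degrees of derivatives -/

lemma mem_polyDeg_iff {r : ℕ} {p : Poly} : p ∈ polyDeg r ↔ p.totalDegree ≤ r :=
  MvPolynomial.mem_restrictTotalDegree _ _ _

lemma polyDeg_mono {r s : ℕ} (h : r ≤ s) : polyDeg r ≤ polyDeg s := fun _ hp =>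
  mem_polyDeg_iff.2 ((mem_polyDeg_iff.1 hp).trans h)

lemma pderiv_mem_polyDeg {r : ℕ} {p : Poly} (i : Fin 3) (hp : p ∈ polyDeg (r + 1)) :
    MvPolynomial.pderiv i p ∈ polyDeg r := by
  rw [mem_polyDeg_iff] at hp ⊢
  refine Finset.sup_le fun m hm => ?_
  -- The coefficient of `m` in the derivative is a multiple of the coefficient of `m + e_i` in `p`.
  have h : m + Finsupp.single i 1 ∈ p.support := by
    rw [MvPolynomial.mem_support_iff, MvPolynomial.coeff_pderiv] at *
    exact left_ne_zero_of_mul hm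
  have h2 := MvPolynomial.le_totalDegree h
  rw [Finsupp.sum_add_index' (by simp) (by simp)] at h2
  simp only [Finsupp.sum_single_index] at h2
  omega

lemma pderiv_mem_polyDeg_self {r : ℕ} {p : Poly} (i : Fin 3) (hp : p ∈ polyDeg r) :
    MvPolynomial.pderiv i p ∈ polyDeg r :=
  pderiv_mem_polyDeg i (polyDeg_mono r.le_succ hp)

lemma X_mul_mem_polyDeg {r : ℕ} {p : Poly} (i : Fin 3) (hp : p ∈ polyDeg r) :
    MvPolynomial.X i * p ∈ polyDeg (r + 1) := by
  rw [mem_polyDeg_iff] at *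
  refine (MvPolynomial.totalDegree_mul _ _).trans ?_
  rw [MvPolynomial.totalDegree_X]
  omega

/-- Multiplication by `X j` restores the degree lost by differentiating. Degree zero is separate:
there the derivative vanishes, and no degree is left to lower. -/
lemma X_mul_pderiv_mem_polyDeg {r : ℕ} {p : Poly} (i j : Fin 3) (hp : p ∈ polyDeg r) :
    MvPolynomial.X j * MvPolynomial.pderiv i p ∈ polyDeg r := by
  cases r with
  | zero =>
    rw [mem_polyDeg_iff, Nat.le_zero, MvPolynomial.totalDegree_eq_zero_iff_eq_C] at hp
    rw [hp, MvPolynomial.pderiv_C, mul_zero]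
    exact zero_mem _
  | succ r => exact X_mul_mem_polyDeg j (pderiv_mem_polyDeg i hp)

lemma curlP_mem_localRT {r : ℕ} {v : VecPoly} (hv : v ∈ localNedelec r) :
    curlP v ∈ localRT r := by
  obtain ⟨a, b, ha, hb, rfl⟩ := hv
  -- The witnesses come from `curl (x × b) = x div b - 2 b - (x · ∇) b`, whose last two terms stay
  -- in degree `r`.
  refine ⟨fun i => curlP a i - (b i + b i) - ∑ j, MvPolynomial.X j * MvPolynomial.pderiv j (b i),
    divP b, fun i => ?_, ?_, ?_⟩
  · refine sub_mem (sub_mem ?_ (add_mem (hb i) (hb i)))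
      (Submodule.sum_mem _ fun j _ => X_mul_pderiv_mem_polyDeg _ _ (hb i))
    fin_cases i <;>
      exact sub_mem (pderiv_mem_polyDeg_self _ (ha _)) (pderiv_mem_polyDeg_self _ (ha _))
  · exact Submodule.sum_mem _ fun j _ => pderiv_mem_polyDeg_self _ (hb j)
  · have hX (i j : Fin 3) (h : j ≠ i) := MvPolynomial.pderiv_X_of_ne (R := ℝ) h
    ext1 i
    fin_cases i <;>
      simp [curlP, divP, crossProduct, Fin.sum_univ_three, hX] <;>
      ring

lemma gradP_mem_localNedelec {r : ℕ} {p : Poly} (hp : p ∈ polyDeg (r + 1)) :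
    gradP p ∈ localNedelec r :=
  ⟨gradP p, 0, fun i => pderiv_mem_polyDeg i hp, fun _ => zero_mem _, by simp⟩

lemma localRT_le {r : ℕ} {v : VecPoly} (hv : v ∈ localRT r) (i : Fin 3) :
    v i ∈ polyDeg (r + 1) := by
  obtain ⟨a, b, ha, hb, rfl⟩ := hv
  exact add_mem (polyDeg_mono r.le_succ (ha i)) (X_mul_mem_polyDeg i hb)

lemma localNedelec_le {r : ℕ} {v : VecPoly} (hv : v ∈ localNedelec r) (i : Fin 3) :
    v i ∈ polyDeg (r + 1) := by
  obtain ⟨a, b, ha, hb, rfl⟩ := hv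
  refine add_mem (polyDeg_mono r.le_succ (ha i)) ?_
  fin_cases i <;> exact sub_mem (X_mul_mem_polyDeg _ (hb _)) (X_mul_mem_polyDeg _ (hb _))

/-! ### Vector calculus identities -/

/-- The commutator of two derivations is a derivation, so it suffices that it kills the variables.
-/
lemma pderiv_comm (i j : Fin 3) (p : Poly) :
    MvPolynomial.pderiv i (MvPolynomial.pderiv j p) =
      MvPolynomial.pderiv j (MvPolynomial.pderiv i p) := by
  have h : ⁅MvPolynomial.pderiv (R := ℝ) i, MvPolynomial.pderiv (R := ℝ) j⁆ = 0 := by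
    refine MvPolynomial.derivation_ext fun k => ?_
    simp [Derivation.commutator_apply, MvPolynomial.pderiv_X, Pi.single_apply, apply_ite]
  have := DFunLike.congr_fun h p
  rwa [Derivation.commutator_apply, Derivation.zero_apply, sub_eq_zero] at this

lemma divP_curlP (v : VecPoly) : divP (curlP v) = 0 := by
  simp [divP, curlP, Fin.sum_univ_three, pderiv_comm 1 0, pderiv_comm 2 0, pderiv_comm 2 1]

lemma curlP_gradP (p : Poly) : curlP (gradP p) = 0 := by
  ext1 i
  fin_cases i <;> simp [curlP, gradP, pderiv_comm 1 0, pderiv_comm 2 0, pderiv_comm 2 1]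

/-! ### Linearity of evaluation and of the differential operators -/

lemma evalS_sub (p q : Poly) (x : E3) : evalS (p - q) x = evalS p x - evalS q x := by
  simp [evalS]

lemma evalV_sub (u v : VecPoly) (x : E3) : evalV (u - v) x = evalV u x - evalV v x := by
  ext i; simp [evalV, evalS_sub]

lemma gradP_sub (p q : Poly) : gradP (p - q) = gradP p - gradP q := by
  ext1 i; simp [gradP]

lemma gradP_add (p q : Poly) : gradP (p + q) = gradP p + gradP q := by
  ext1 i; simp [gradP]

lemma gradP_smul (c : ℝ) (p : Poly) : gradP (c • p) = c • gradP p := by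
  ext1 i; simp [gradP]

lemma curlP_sub (u v : VecPoly) : curlP (u - v) = curlP u - curlP v := by
  ext1 i; fin_cases i <;> simp [curlP] <;> ring

lemma curlP_add (u v : VecPoly) : curlP (u + v) = curlP u + curlP v := by
  ext1 i; fin_cases i <;> simp [curlP] <;> ring

lemma curlP_smul (c : ℝ) (v : VecPoly) : curlP (c • v) = c • curlP v := by
  ext1 i; fin_cases i <;> simp [curlP, smul_sub]

lemma divP_add (u v : VecPoly) : divP (u + v) = divP u + divP v := by
  simp [divP, Finset.sum_add_distrib]

lemma divP_smul (c : ℝ) (v : VecPoly) : divP (c • v) = c • divP v := by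
  simp [divP, Finset.smul_sum]

lemma continuous_evalS (p : Poly) : Continuous (evalS p) := by
  unfold evalS
  exact (MvPolynomial.continuous_eval p).comp (PiLp.continuous_ofLp 2 _)

lemma continuous_evalV (v : VecPoly) : Continuous (evalV v) :=
  (PiLp.continuous_toLp 2 _).comp (continuous_pi fun i => continuous_evalS (v i))

lemma inner_evalV (v : VecPoly) (x u : E3) : ⟪evalV v x, u⟫ = ∑ i, evalS (v i) x * u i := by
  simp [PiLp.inner_apply, evalV, mul_comm]

/-! ### Traces on faces -/

lemma hasDerivAt_evalS_line (p : Poly) (x u : E3) (t : ℝ) :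
    HasDerivAt (fun t : ℝ => evalS p (x + t • u)) ⟪evalV (gradP p) (x + t • u), u⟫ t := by
  simp only [inner_evalV, gradP]
  induction p using MvPolynomial.induction_on with
  | C a => simpa [evalS] using hasDerivAt_const t a
  | add p q hp hq =>
    simp only [evalS_add, map_add, add_mul, Finset.sum_add_distrib]
    exact hp.add hq
  | mul_X p j hp =>
    have hX : HasDerivAt (fun t : ℝ => evalS (MvPolynomial.X j) (x + t • u)) (u j) t := by
      simp only [evalS, MvPolynomial.eval_X, PiLp.add_apply, PiLp.smul_apply, smul_eq_mul]
      simpa using ((hasDerivAt_id t).mul_const (u j)).const_add (x j)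
    have h := hp.mul hX
    have e1 : (fun t : ℝ => evalS (p * MvPolynomial.X j) (x + t • u)) =
        (fun t : ℝ => evalS p (x + t • u)) * fun t : ℝ => evalS (MvPolynomial.X j) (x + t • u) := by
      ext; simp [evalS]
    rw [e1]
    refine h.congr_deriv ?_
    fin_cases j <;>
      simp [Fin.sum_univ_three, evalS, MvPolynomial.pderiv_X,
        Pi.single_apply] <;> ring

/-- The gradient of a polynomial that vanishes on a convex set is orthogonal to that set. -/
lemma inner_gradP_eq_zero {p : Poly} {S : Set E3} (hS : Convex ℝ S)
    (hp : ∀ x ∈ S, evalS p x = 0) {x u : E3} (hx : x ∈ S) (hu : u ∈ vectorSpan ℝ S) :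
    ⟪evalV (gradP p) x, u⟫ = 0 := by
  have key : ∀ y ∈ S, ⟪evalV (gradP p) x, y - x⟫ = 0 := by
    intro y hy
    -- The derivative is one-sided because `x` may lie on the relative boundary of `S`; only the
    -- segment from `x` to `y` is known to lie in `S`.
    have h1 := (hasDerivAt_evalS_line p x (y - x) 0).hasDerivWithinAt (s := Set.Icc 0 1)
    rw [zero_smul, add_zero] at h1
    have h2 : HasDerivWithinAt (fun t : ℝ => evalS p (x + t • (y - x))) 0 (Set.Icc 0 1) 0 :=
      (hasDerivWithinAt_const (0 : ℝ) (Set.Icc (0 : ℝ) 1) (0 : ℝ)).congr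
        (fun t ht => hp _ (hS.add_smul_sub_mem hx hy ht)) (by simpa using hp x hx)
    exact (uniqueDiffOn_Icc zero_lt_one 0 (by simp)).eq_deriv _ h1 h2
  rw [vectorSpan_eq_span_vsub_set_right ℝ hx] at hu
  induction hu using Submodule.span_induction with
  | mem z hz => obtain ⟨y, hy, rfl⟩ := hz; exact key y hy
  | zero => simp
  | add a b _ _ ha hb => rw [inner_add_right, ha, hb, add_zero]
  | smul c a _ ha => rw [inner_smul_right, ha, mul_zero]

lemma vectorSpan_simplex (F : Finset E3) :
    vectorSpan ℝ (simplex F) = vectorSpan ℝ (F : Set E3) := by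
  rw [← direction_affineSpan, simplex, affineSpan_convexHull, direction_affineSpan]

lemma tanPart_eq_zero_iff {F : Finset E3} {v : E3} :
    tanPart F v = 0 ↔ ∀ u ∈ vectorSpan ℝ (F : Set E3), ⟪v, u⟫ = 0 := by
  rw [tanPart, Submodule.starProjection_apply_eq_zero_iff, Submodule.mem_orthogonal']

lemma tanPart_gradP_eq_zero {p : Poly} {F : Finset E3} (hp : ∀ x ∈ simplex F, evalS p x = 0)
    {x : E3} (hx : x ∈ simplex F) : tanPart F (evalV (gradP p) x) = 0 :=
  tanPart_eq_zero_iff.2 fun _ hu =>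
    inner_gradP_eq_zero (convex_convexHull ℝ _) hp hx ((vectorSpan_simplex F).symm ▸ hu)

lemma inner_normalPart (F : Finset E3) (v : E3) {u : E3} (hu : u ∈ vectorSpan ℝ (F : Set E3)) :
    ⟪normalPart F v, u⟫ = 0 :=
  (Submodule.mem_orthogonal' _ _).1 (Submodule.sub_starProjection_mem_orthogonal v) u hu

lemma tanPart_mem (F : Finset E3) (v : E3) : tanPart F v ∈ vectorSpan ℝ (F : Set E3) :=
  Submodule.starProjection_apply_mem _ v

lemma finrank_vectorSpan_face {K F : Finset E3} (hK : AffineIndependent ℝ (fun x : K => (x : E3)))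
    (hFK : F ⊆ K) (hF : F.card = 3) : Module.finrank ℝ (vectorSpan ℝ (F : Set E3)) = 2 := by
  have h : AffineIndependent ℝ (fun x : F => (x : E3)) :=
    AffineIndependent.mono (s := (F : Set E3)) (t := (K : Set E3)) hK hFK
  have := h.finrank_vectorSpan (n := 2) (by simpa using hF)
  rwa [Subtype.range_coe_subtype] at this

/-- If the tangential trace of `w` vanishes on a triangle, so does the normal trace of `curl w`. -/
lemma normalPart_curlP_eq_zero {w : VecPoly} {F : Finset E3}
    (hF : Module.finrank ℝ (vectorSpan ℝ (F : Set E3)) = 2)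
    (hw : ∀ x ∈ simplex F, tanPart F (evalV w x) = 0) {x : E3} (hx : x ∈ simplex F) :
    normalPart F (evalV (curlP w) x) = 0 := by
  -- For `u` tangent to the face, the polynomial `w · u` vanishes on the face, hence so does its
  -- derivative in any tangent direction `u'`.
  have D : ∀ u ∈ vectorSpan ℝ (F : Set E3), ∀ u' ∈ vectorSpan ℝ (F : Set E3),
      ∑ j, ∑ i, u i * evalS (MvPolynomial.pderiv j (w i)) x * u' j = 0 := by
    intro u hu u' hu'
    have h := inner_gradP_eq_zero (p := ∑ i, u i • w i) (convex_convexHull ℝ _)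
      (fun y hy => ?_) hx ((vectorSpan_simplex F).symm ▸ hu')
    · simpa [inner_evalV, gradP, Fin.sum_univ_three, evalS, MvPolynomial.smul_eval, add_mul] using h
    · have := tanPart_eq_zero_iff.1 (hw y hy) u hu
      rw [inner_evalV] at this
      simpa [Fin.sum_univ_three, evalS, MvPolynomial.smul_eval, mul_comm] using this
  let b := Module.finBasisOfFinrankEq ℝ _ hF
  set u : E3 := (b 0 : E3)
  set u' : E3 := (b 1 : E3)
  have hu : u ∈ vectorSpan ℝ (F : Set E3) := (b 0).2
  have hu' : u' ∈ vectorSpan ℝ (F : Set E3) := (b 1).2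
  have hli : LinearIndependent ℝ ![u.ofLp, u'.ofLp] := by
    have h := (b.linearIndependent.map' (Submodule.subtype _) (Submodule.ker_subtype _)).map'
      (WithLp.linearEquiv 2 ℝ (Fin 3 → ℝ)).toLinearMap (LinearEquiv.ker _)
    have e : ![u.ofLp, u'.ofLp] = WithLp.linearEquiv 2 ℝ (Fin 3 → ℝ) ∘
        (vectorSpan ℝ (F : Set E3)).subtype ∘ b := by
      ext i; fin_cases i <;> rfl
    rw [e]
    exact h
  have hn := crossProduct_ne_zero_iff_linearIndependent.2 hli
  set ν := normalPart F (evalV (curlP w) x) with hν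
  have h1 := D u hu u' hu'
  have h2 := D u' hu' u hu
  have h3 := inner_normalPart F (evalV (curlP w) x) hu
  have h4 := inner_normalPart F (evalV (curlP w) x) hu'
  rw [← hν] at h3 h4
  -- Antisymmetrizing `D` in `u` and `u'` leaves exactly `curl w · (u × u')`.
  have hC : ∑ i, evalV (curlP w) x i * crossProduct u.ofLp u'.ofLp i = 0 := by
    simp [Fin.sum_univ_three, evalV, evalS, curlP, crossProduct] at h1 h2 ⊢
    linarith
  have hT : ∑ i, tanPart F (evalV (curlP w) x) i * crossProduct u.ofLp u'.ofLp i = 0 := by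
    obtain ⟨c, hc⟩ : ∃ c : Fin 2 → ℝ, tanPart F (evalV (curlP w) x) = c 0 • u + c 1 • u' := by
      refine ⟨b.repr ⟨_, tanPart_mem F (evalV (curlP w) x)⟩, ?_⟩
      have := congrArg Subtype.val (b.sum_repr ⟨_, tanPart_mem F (evalV (curlP w) x)⟩)
      rw [Fin.sum_univ_two] at this
      exact this.symm
    rw [hc]
    simp [Fin.sum_univ_three, crossProduct]
    ring
  have h5 : ∑ i, ν i * crossProduct u.ofLp u'.ofLp i = 0 := by
    rw [hν]
    simp only [normalPart, PiLp.sub_apply, sub_mul, Finset.sum_sub_distrib, hC, hT, sub_zero]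
  rw [PiLp.inner_apply] at h3 h4
  simp only [Fin.sum_univ_three, RCLike.inner_apply, conj_trivial] at h3 h4 h5
  have hpos : 0 < ∑ i, (crossProduct u.ofLp u'.ofLp i) ^ 2 := by
    obtain ⟨i, hi⟩ := Function.ne_iff.1 hn
    exact Finset.sum_pos' (fun _ _ => sq_nonneg _) ⟨i, Finset.mem_univ _, sq_pos_iff.2 hi⟩
  -- Lagrange's identity `|ν|² |n|² = (ν · n)² + |ν × n|²` for `n = u × u'`, with `ν × n` expanded
  -- as `u (ν · u') - u' (ν · u)`. All terms on the right vanish, while `n` does not.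
  have hprod : (∑ i, ν i ^ 2) * ∑ i, (crossProduct u.ofLp u'.ofLp i) ^ 2 =
      (ν 0 * crossProduct u.ofLp u'.ofLp 0 + ν 1 * crossProduct u.ofLp u'.ofLp 1
        + ν 2 * crossProduct u.ofLp u'.ofLp 2) ^ 2
      + ∑ i, (u i * (u' 0 * ν 0 + u' 1 * ν 1 + u' 2 * ν 2)
        - u' i * (u 0 * ν 0 + u 1 * ν 1 + u 2 * ν 2)) ^ 2 := by
    simp [Fin.sum_univ_three, crossProduct]
    ring
  rw [h3, h4, h5] at hprod
  have h0 : ∑ i, ν i ^ 2 = 0 := by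
    rcases mul_eq_zero.1 (hprod.trans (by simp)) with h | h
    · exact h
    · exact absurd h hpos.ne'
  ext i
  have := (Finset.sum_eq_zero_iff_of_nonneg fun i _ => sq_nonneg (ν i)).1 h0 i (Finset.mem_univ i)
  simpa using this

/-! ### The discrete de Rham sequence -/

/-- Tangential continuity says that the difference of the two cell polynomials has zero tangential
trace on the shared face, so the vanishing-trace result applies to that difference. -/
lemma curlh_mem_raviartThomas {T : Mesh} {r : ℕ} {v : T.cells → VecPoly} (hv : v ∈ nedelec T r) :
    curlh v ∈ raviartThomas T r := by
  obtain ⟨h1, h2, h3⟩ := hv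
  refine ⟨fun K => curlP_mem_localRT (h1 K), fun K L F hF hK hL x hx => ?_,
    fun K F hF hK x hx => ?_⟩
  · have h := normalPart_curlP_eq_zero (w := v K - v L)
      (finrank_vectorSpan_face (T.nondegenerate K K.2) hK hF) (fun y hy => ?_) hx
    · rw [curlP_sub, evalV_sub, sub_eq_add_neg, normalPart_add, ← neg_one_smul ℝ (evalV _ _),
        normalPart_smul, neg_one_smul, ← sub_eq_add_neg, sub_eq_zero] at h
      exact h
    · rw [evalV_sub, sub_eq_add_neg, tanPart_add, ← neg_one_smul ℝ (evalV _ _), tanPart_smul,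
        neg_one_smul, ← sub_eq_add_neg, sub_eq_zero]
      exact h2 K L F hF hK hL y hy
  · exact normalPart_curlP_eq_zero (finrank_vectorSpan_face (T.nondegenerate K K.2) hK hF.1.1)
      (fun y hy => h3 K F hF hK y hy) hx

lemma tanPart_gradh_eq_zero {T : Mesh} {r : ℕ} {p : T.cells → Poly} (hp : p ∈ lagrange T r)
    {K : T.cells} {F : Finset E3} (hF : T.IsBoundaryFace F) (hK : F ⊆ K.1) {x : E3}
    (hx : x ∈ simplex F) : tanPart F (evalV (gradh p K) x) = 0 :=
  tanPart_gradP_eq_zero (fun y hy => hp.2.2 K F hF hK y hy) hx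

lemma gradh_mem_nedelec {T : Mesh} {r : ℕ} {p : T.cells → Poly} (hp : p ∈ lagrange T r) :
    gradh p ∈ nedelec T r := by
  refine ⟨fun K => gradP_mem_localNedelec (hp.1 K), fun K L F hF hK hL x hx => ?_,
    fun K F hF hK x hx => tanPart_gradh_eq_zero hp hF.1 hK hx⟩
  have h := tanPart_gradP_eq_zero (p := p K - p L) (F := F) (fun y hy => ?_) hx
  · rw [gradP_sub, evalV_sub, sub_eq_add_neg, tanPart_add, ← neg_one_smul ℝ (evalV _ _),
      tanPart_smul, neg_one_smul, ← sub_eq_add_neg, sub_eq_zero] at h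
    exact h
  · rw [evalS_sub, sub_eq_zero]
    exact hp.2.1 K L y ⟨convexHull_mono (Finset.coe_subset.2 hK) hy,
      convexHull_mono (Finset.coe_subset.2 hL) hy⟩

/-! ### Simplices of a mesh -/

lemma convex_simplex (K : Finset E3) : Convex ℝ (simplex K) := convex_convexHull ℝ _

lemma isCompact_simplex (K : Finset E3) : IsCompact (simplex K) :=
  K.finite_toSet.isCompact_convexHull ℝ

/-- The weights are controlled only on the open set `T.domain`, which may miss boundary points of a
cell. Since convex sets have null frontier, cell integrals can be taken over interiors, which lie in
`T.domain`. -/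
lemma simplex_ae_eq_interior (K : Finset E3) :
    interior (simplex K) =ᵐ[volume] simplex K :=
  interior_ae_eq_of_null_frontier ((convex_simplex K).addHaar_frontier volume)

lemma Mesh.interior_simplex_subset_domain (T : Mesh) {K : Finset E3} (hK : K ∈ T.cells) :
    interior (simplex K) ⊆ T.domain :=
  interior_mono (Set.subset_biUnion_of_mem (u := fun K => simplex K) hK)

lemma Mesh.interior_simplex_nonempty (T : Mesh) {K : Finset E3} (hK : K ∈ T.cells) :
    (interior (simplex K)).Nonempty := by
  have h := T.nondegenerate K hK
  rw [simplex, interior_convexHull_nonempty_iff_affineSpan_eq_top]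
  have h2 := h.affineSpan_eq_top_iff_card_eq_finrank_add_one.2 (by simp [T.card_eq K hK])
  rwa [Subtype.range_coe_subtype] at h2

/-- A polynomial vanishing on a nonempty open set is zero. -/
lemma eq_zero_of_evalS_eq_zero {p : Poly} {U : Set E3} (hU : IsOpen U) (hne : U.Nonempty)
    (h : ∀ x ∈ U, evalS p x = 0) : p = 0 := by
  obtain ⟨x, hx⟩ := hne
  have hU' : IsOpen ((WithLp.toLp 2 : (Fin 3 → ℝ) → E3) ⁻¹' U) :=
    hU.preimage (PiLp.continuous_toLp 2 _)
  obtain ⟨δ, hδ, hball⟩ := Metric.isOpen_iff.1 hU' x.ofLp hx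
  -- In the sup norm a ball is a product of intervals, and a polynomial vanishing on a product of
  -- infinite sets is zero.
  refine MvPolynomial.funext_set (fun i => Metric.ball (x i) δ) (fun i => ?_) fun y hy => ?_
  · rw [Real.ball_eq_Ioo]
    exact Set.Ioo_infinite (by linarith)
  · rw [← ball_pi _ hδ] at hy
    simpa [evalS] using h _ (hball hy)

/-- The surface measure of a triangle is finite. -/
lemma hausdorff_simplex_lt_top {F : Finset E3} (hF : F.card = 3) : μHE[2] (simplex F) < ⊤ := by
  obtain ⟨a, b, c, -, -, -, rfl⟩ := Finset.card_eq_three.1 hF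
  let f : (Fin 2 → ℝ) →ₗ[ℝ] E3 :=
    (LinearMap.proj 0).smulRight (b - a) + (LinearMap.proj 1).smulRight (c - a)
  let g : (Fin 2 → ℝ) →L[ℝ] E3 := LinearMap.toContinuousLinearMap f
  have hg (v : Fin 2 → ℝ) : g v = v 0 • (b - a) + v 1 • (c - a) := rfl
  have hL : LipschitzWith ‖g‖₊ (fun v => g v + a) := fun v w => by
    simpa using g.lipschitz v w
  -- The triangle is covered by a parallelogram, the Lipschitz image of the unit square.
  have hsub : simplex {a, b, c} ⊆ (fun v => g v + a) '' Set.Icc 0 1 := by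
    refine convexHull_min ?_ ?_
    · intro x hx
      simp only [Finset.coe_insert, Finset.coe_singleton, Set.mem_insert_iff,
        Set.mem_singleton_iff] at hx
      rcases hx with rfl | rfl | rfl
      · exact ⟨0, by simp, by simp⟩
      · exact ⟨Pi.single 0 1, ⟨by simp, fun i => by fin_cases i <;> simp⟩, by simp [hg]⟩
      · exact ⟨Pi.single 1 1, ⟨by simp, fun i => by fin_cases i <;> simp⟩, by simp [hg]⟩
    · have h := ((convex_Icc (0 : Fin 2 → ℝ) 1).linear_image f).translate a
      convert h using 1
      rw [Set.image_image]
      refine Set.image_congr fun v _ => ?_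
      exact add_comm _ _
  have hfin : μH[(2 : ℕ)] (simplex {a, b, c}) < ⊤ := by
    refine (measure_mono hsub).trans_lt ((hL.hausdorffMeasure_image_le (by simp) _).trans_lt ?_)
    have h := hausdorffMeasure_pi_real (ι := Fin 2)
    rw [Fintype.card_fin] at h
    rw [h]
    refine ENNReal.mul_lt_top ?_ (isCompact_Icc.measure_lt_top)
    exact ENNReal.rpow_lt_top_of_nonneg (by simp) (by simp)
  rw [Measure.euclideanHausdorffMeasure_def, Measure.smul_apply, ENNReal.smul_def, smul_eq_mul]
  exact ENNReal.mul_lt_top (by simp) hfin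

/-! ### Weighted inner products -/

/-- Positive integrable weights on the domain of a mesh. -/
structure IsWeight (T : Mesh) (w : E3 → ℝ) : Prop where
  pos : ∀ x ∈ T.domain, 0 < w x
  integrableOn : IntegrableOn w T.domain

namespace IsWeight

variable {T : Mesh} {w : E3 → ℝ}

lemma integrableOn_simplex (hw : IsWeight T w) {K : Finset E3} (hK : K ∈ T.cells) :
    IntegrableOn w (simplex K) :=
  (hw.integrableOn.mono_set (T.interior_simplex_subset_domain hK)).congr_set_ae
    (simplex_ae_eq_interior K).symm

lemma integrableOn_mul (hw : IsWeight T w) {K : Finset E3} (hK : K ∈ T.cells) {g : E3 → ℝ}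
    (hg : Continuous g) : IntegrableOn (fun x => w x * g x) (simplex K) :=
  (hw.integrableOn_simplex hK).mul_continuousOn hg.continuousOn (isCompact_simplex K)

lemma setIntegral_eq_interior (K : Finset E3) (f : E3 → ℝ) :
    ∫ x in simplex K, f x = ∫ x in interior (simplex K), f x :=
  setIntegral_congr_set (simplex_ae_eq_interior K).symm

lemma integral_nonneg (hw : IsWeight T w) {K : Finset E3} (hK : K ∈ T.cells) {g : E3 → ℝ}
    (hg : ∀ x, 0 ≤ g x) : 0 ≤ ∫ x in simplex K, w x * g x := by
  rw [setIntegral_eq_interior]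
  exact setIntegral_nonneg isOpen_interior.measurableSet fun x hx =>
    mul_nonneg (hw.pos x (T.interior_simplex_subset_domain hK hx)).le (hg x)

lemma eq_zero_of_integral_eq_zero (hw : IsWeight T w) {K : Finset E3} (hK : K ∈ T.cells)
    {g : E3 → ℝ} (hgc : Continuous g) (hg : ∀ x, 0 ≤ g x)
    (h : ∫ x in simplex K, w x * g x = 0) : ∀ x ∈ interior (simplex K), g x = 0 := by
  have hpos x (hx : x ∈ interior (simplex K)) : 0 < w x :=
    hw.pos x (T.interior_simplex_subset_domain hK hx)
  rw [setIntegral_eq_interior, setIntegral_eq_zero_iff_of_nonneg_ae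
    ((ae_restrict_iff' isOpen_interior.measurableSet).2
      (.of_forall fun x hx => mul_nonneg (hpos x hx).le (hg x)))
    ((hw.integrableOn_mul hK hgc).mono_set interior_subset)] at h
  have h' : g =ᵐ[volume.restrict (interior (simplex K))] 0 := by
    filter_upwards [h, ae_restrict_mem isOpen_interior.measurableSet] with x hx hxm
    exact (mul_eq_zero.1 hx).resolve_left (hpos x hxm).ne'
  -- Continuity of `g` upgrades vanishing almost everywhere to vanishing everywhere on the open
  -- interior.
  exact Measure.eqOn_open_of_ae_eq h' isOpen_interior hgc.continuousOn continuousOn_const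

end IsWeight

lemma isWeight_one (T : Mesh) : IsWeight T 1 where
  pos _ _ := zero_lt_one
  integrableOn := by
    refine integrableOn_const (lt_top_iff_ne_top.1 ?_)
    refine (measure_mono interior_subset).trans_lt ?_
    exact (T.cells.finite_toSet.isCompact_biUnion fun K _ => isCompact_simplex K).measure_lt_top

section Forms

variable {T : Mesh} {w : E3 → ℝ}

lemma continuous_inner_evalV (u v : VecPoly) : Continuous fun x => ⟪evalV u x, evalV v x⟫ :=
  (continuous_evalV u).inner (continuous_evalV v)

lemma innerV_comm (w : E3 → ℝ) (u v : T.cells → VecPoly) : innerV w u v = innerV w v u := by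
  simp only [innerV, real_inner_comm]

lemma innerS_comm (p q : T.cells → Poly) : innerS p q = innerS q p := by
  simp only [innerS, mul_comm]

lemma innerGamma_comm (u v : T.cells → VecPoly) : innerGamma u v = innerGamma v u := by
  simp only [innerGamma, real_inner_comm]

lemma IsWeight.innerV_add_left (hw : IsWeight T w) (u u' v : T.cells → VecPoly) :
    innerV w (u + u') v = innerV w u v + innerV w u' v := by
  simp only [innerV, Pi.add_apply, evalV_add, inner_add_left, mul_add, ← Finset.sum_add_distrib]
  refine Finset.sum_congr rfl fun K _ => integral_add ?_ ?_ <;>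
    exact hw.integrableOn_mul K.2 (continuous_inner_evalV _ _)

lemma innerV_smul_left (w : E3 → ℝ) (c : ℝ) (u v : T.cells → VecPoly) :
    innerV w (c • u) v = c * innerV w u v := by
  simp only [innerV, Pi.smul_apply, evalV_smul, real_inner_smul_left, mul_left_comm _ c,
    integral_const_mul, Finset.mul_sum]

/-- Inserting the constant weight `1` makes the results on weights available for the scalar product.
-/
lemma innerS_eq (p q : T.cells → Poly) : innerS p q =
    ∑ K : T.cells, ∫ x in simplex K.1, (1 : E3 → ℝ) x * (evalS (p K) x * evalS (q K) x) := by
  simp [innerS]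

lemma innerS_add_left (p p' q : T.cells → Poly) :
    innerS (p + p') q = innerS p q + innerS p' q := by
  simp only [innerS_eq, Pi.add_apply, evalS_add, add_mul, mul_add, ← Finset.sum_add_distrib]
  refine Finset.sum_congr rfl fun K _ => integral_add ?_ ?_ <;>
    exact (isWeight_one T).integrableOn_mul K.2 ((continuous_evalS _).mul (continuous_evalS _))

lemma innerS_smul_left (c : ℝ) (p q : T.cells → Poly) : innerS (c • p) q = c * innerS p q := by
  simp only [innerS, Pi.smul_apply, evalS_smul, mul_assoc, integral_const_mul, Finset.mul_sum]

lemma continuous_inner_tanPart (F : Finset E3) (u v : VecPoly) :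
    Continuous fun x => ⟪tanPart F (evalV u x), tanPart F (evalV v x)⟫ :=
  (((vectorSpan ℝ (F : Set E3)).starProjection.continuous).comp (continuous_evalV u)).inner
    (((vectorSpan ℝ (F : Set E3)).starProjection.continuous).comp (continuous_evalV v))

lemma integrableOn_inner_tanPart {F : Finset E3} (hF : F.card = 3) (u v : VecPoly) :
    IntegrableOn (fun x => ⟪tanPart F (evalV u x), tanPart F (evalV v x)⟫) (simplex F)
      μHE[2] := by
  have : IsFiniteMeasure ((μHE[2] : Measure E3).restrict (simplex F)) :=
    ⟨by simpa using hausdorff_simplex_lt_top hF⟩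
  obtain ⟨C, hC⟩ := (isCompact_simplex F).exists_bound_of_continuousOn
    (continuous_inner_tanPart F u v).continuousOn
  exact Integrable.of_bound (continuous_inner_tanPart F u v).aestronglyMeasurable C
    ((ae_restrict_iff' (isCompact_simplex F).measurableSet).2 (.of_forall hC))

lemma innerGamma_add_left (u u' v : T.cells → VecPoly) :
    innerGamma (u + u') v = innerGamma u v + innerGamma u' v := by
  simp only [innerGamma, Pi.add_apply, evalV_add, tanPart_add, inner_add_left,
    ← Finset.sum_add_distrib]
  refine Finset.sum_congr rfl fun F hF => Finset.sum_congr rfl fun K _ => integral_add ?_ ?_ <;>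
    exact integrableOn_inner_tanPart (T.gammaI_boundary F hF).1 _ _

lemma innerGamma_smul_left (c : ℝ) (u v : T.cells → VecPoly) :
    innerGamma (c • u) v = c * innerGamma u v := by
  simp only [innerGamma, Pi.smul_apply, evalV_smul, tanPart_smul, real_inner_smul_left,
    integral_const_mul, Finset.mul_sum]

lemma innerGamma_self_nonneg (u : T.cells → VecPoly) : 0 ≤ innerGamma u u :=
  Finset.sum_nonneg fun _ _ => Finset.sum_nonneg fun _ _ =>
    integral_nonneg fun _ => real_inner_self_nonneg

lemma IsWeight.innerV_self_nonneg (hw : IsWeight T w) (u : T.cells → VecPoly) :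
    0 ≤ innerV w u u :=
  Finset.sum_nonneg fun K _ => hw.integral_nonneg K.2 fun _ => real_inner_self_nonneg

lemma innerS_self_nonneg (p : T.cells → Poly) : 0 ≤ innerS p p :=
  Finset.sum_nonneg fun _ _ => integral_nonneg fun _ => mul_self_nonneg _

lemma IsWeight.innerV_self_eq_zero (hw : IsWeight T w) {u : T.cells → VecPoly}
    (h : innerV w u u = 0) : u = 0 := by
  ext1 K
  have hK := (Finset.sum_eq_zero_iff_of_nonneg fun K _ =>
    hw.integral_nonneg K.2 fun _ => real_inner_self_nonneg).1 h K (Finset.mem_univ K)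
  have h0 := hw.eq_zero_of_integral_eq_zero K.2 (continuous_inner_evalV _ _)
    (fun _ => real_inner_self_nonneg) hK
  ext1 i
  refine eq_zero_of_evalS_eq_zero isOpen_interior (T.interior_simplex_nonempty K.2) fun x hx => ?_
  have h1 := congrArg (fun v : E3 => v i) (inner_self_eq_zero.1 (h0 x hx))
  simpa [evalV] using h1

lemma innerS_self_eq_zero {p : T.cells → Poly} (h : innerS p p = 0) : p = 0 := by
  rw [innerS_eq] at h
  ext1 K
  have hK := (Finset.sum_eq_zero_iff_of_nonneg fun K _ =>
    (isWeight_one T).integral_nonneg K.2 fun _ => mul_self_nonneg _).1 h K (Finset.mem_univ K)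
  have h0 := (isWeight_one T).eq_zero_of_integral_eq_zero K.2
    ((continuous_evalS _).mul (continuous_evalS _)) (fun _ => mul_self_nonneg _) hK
  exact eq_zero_of_evalS_eq_zero isOpen_interior (T.interior_simplex_nonempty K.2)
    fun x hx => mul_self_eq_zero.1 (h0 x hx)

/-- Lagrange functions vanish on the whole boundary, `Γ_i` included, so their gradients are normal
there. Adding a gradient to a test field thus leaves the impedance term unchanged. -/
lemma innerGamma_gradh_eq_zero {r : ℕ} (u : T.cells → VecPoly) {p : T.cells → Poly}
    (hp : p ∈ lagrange T r) : innerGamma u (gradh p) = 0 := by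
  refine Finset.sum_eq_zero fun F hF => Finset.sum_eq_zero fun K hK =>
    setIntegral_eq_zero_of_forall_eq_zero fun x hx => ?_
  rw [tanPart_gradh_eq_zero hp (T.gammaI_boundary F hF) (Finset.mem_filter.1 hK).2 hx,
    inner_zero_right]

/-- The weighted `L²` inner product as a bilinear form. -/
noncomputable def IsWeight.form (hw : IsWeight T w) :
    (T.cells → VecPoly) →ₗ[ℝ] (T.cells → VecPoly) →ₗ[ℝ] ℝ :=
  LinearMap.mk₂ ℝ (innerV w) hw.innerV_add_left (innerV_smul_left w)
    (fun u _ _ => by simp only [innerV_comm w u, hw.innerV_add_left])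
    (fun _ u _ => by simp only [innerV_comm w u, innerV_smul_left, smul_eq_mul])

/-- The scalar `L²` inner product as a bilinear form. -/
noncomputable def scalarForm (T : Mesh) : (T.cells → Poly) →ₗ[ℝ] (T.cells → Poly) →ₗ[ℝ] ℝ :=
  LinearMap.mk₂ ℝ innerS innerS_add_left innerS_smul_left
    (fun u _ _ => by simp only [innerS_comm u, innerS_add_left])
    (fun _ u _ => by simp only [innerS_comm u, innerS_smul_left, smul_eq_mul])

/-- The `L²` inner product of tangential traces as a bilinear form. -/
noncomputable def gammaForm (T : Mesh) :
    (T.cells → VecPoly) →ₗ[ℝ] (T.cells → VecPoly) →ₗ[ℝ] ℝ :=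
  LinearMap.mk₂ ℝ innerGamma innerGamma_add_left innerGamma_smul_left
    (fun u _ _ => by simp only [innerGamma_comm u, innerGamma_add_left])
    (fun _ u _ => by simp only [innerGamma_comm u, innerGamma_smul_left, smul_eq_mul])

end Forms

/-! ### Finite dimensionality and differential operators on the discrete spaces -/

section Spaces

variable (T : Mesh) (r : ℕ)

instance (n : ℕ) : FiniteDimensional ℝ (polyDeg n) :=
  inferInstanceAs (Module.Finite ℝ (MvPolynomial.restrictTotalDegree (Fin 3) ℝ n))

lemma finiteDimensional_of_forall_mem_polyDeg {T : Mesh} {n : ℕ}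
    {S : Submodule ℝ (T.cells → VecPoly)} (h : ∀ v ∈ S, ∀ K i, v K i ∈ polyDeg n) :
    FiniteDimensional ℝ S :=
  FiniteDimensional.of_injective (V₂ := T.cells → Fin 3 → polyDeg n)
    { toFun v K i := ⟨v.1 K i, h v.1 v.2 K i⟩
      map_add' _ _ := rfl
      map_smul' _ _ := rfl } fun _ _ huv => Subtype.ext <| funext fun K => funext fun i =>
        congrArg Subtype.val (congrFun (congrFun huv K) i)

instance : FiniteDimensional ℝ (raviartThomas T r) :=
  finiteDimensional_of_forall_mem_polyDeg fun _ hv K i => localRT_le (hv.1 K) i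

instance : FiniteDimensional ℝ (nedelec T r) :=
  finiteDimensional_of_forall_mem_polyDeg fun _ hv K i => localNedelec_le (hv.1 K) i

instance : FiniteDimensional ℝ (lagrange T r) :=
  FiniteDimensional.of_injective (V₂ := T.cells → polyDeg (r + 1))
    { toFun v K := ⟨v.1 K, v.2.1 K⟩
      map_add' _ _ := rfl
      map_smul' _ _ := rfl } fun _ _ huv => Subtype.ext <| funext fun K =>
        congrArg Subtype.val (congrFun huv K)

/-- The discrete curl. -/
noncomputable def curlMap : nedelec T r →ₗ[ℝ] raviartThomas T r where
  toFun v := ⟨curlh v.1, curlh_mem_raviartThomas v.2⟩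
  map_add' _ _ := Subtype.ext <| funext fun _ => curlP_add _ _
  map_smul' c _ := Subtype.ext <| funext fun _ => curlP_smul c _

/-- The discrete gradient. -/
noncomputable def gradMap : lagrange T r →ₗ[ℝ] nedelec T r where
  toFun p := ⟨gradh p.1, gradh_mem_nedelec p.2⟩
  map_add' _ _ := Subtype.ext <| funext fun _ => gradP_add _ _
  map_smul' c _ := Subtype.ext <| funext fun _ => gradP_smul c _

/-- The discrete divergence. -/
noncomputable def divMap : raviartThomas T r →ₗ[ℝ] (T.cells → Poly) where
  toFun v := divh v.1
  map_add' _ _ := funext fun _ => divP_add _ _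
  map_smul' c _ := funext fun _ => divP_smul c _

end Spaces

/-! ### Abstract mixed problem -/

section Abstract

variable {X Y Z W : Type*} [AddCommGroup X] [Module ℝ X] [AddCommGroup Y] [Module ℝ Y]
  [AddCommGroup Z] [Module ℝ Z] [AddCommGroup W] [Module ℝ W]

/-- A positive definite symmetric bilinear form admits projections onto subspaces. -/
lemma exists_projection [FiniteDimensional ℝ X] (m : X →ₗ[ℝ] X →ₗ[ℝ] ℝ)
    (hm : ∀ x, m x x = 0 → x = 0) (S : Submodule ℝ X) (x : X) :
    ∃ y ∈ S, ∀ z ∈ S, m y z = m x z := by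
  let f : S →ₗ[ℝ] Module.Dual ℝ S := (m.compl₂ S.subtype).comp S.subtype
  -- Definiteness of `m` on `S` makes `S → S*` injective, hence onto by equality of dimensions; `y`
  -- represents `m x` on `S`.
  have hf : Function.Injective f := by
    rw [injective_iff_map_eq_zero]
    intro y hy
    exact Subtype.ext (hm y (LinearMap.congr_fun hy y))
  obtain ⟨y, hy⟩ := (LinearMap.injective_iff_surjective_of_finrank_eq_finrank
    (Subspace.dual_finrank_eq (K := ℝ) (V := S)).symm).1 hf ((m x).comp S.subtype)
  exact ⟨y, y.2, fun z hz => LinearMap.congr_fun hy ⟨z, hz⟩⟩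

lemma abs_two_mul_form_le (m : X →ₗ[ℝ] X →ₗ[ℝ] ℝ) (hs : ∀ x y, m x y = m y x)
    (hm : ∀ x, 0 ≤ m x x) (x y : X) : |2 * m x y| ≤ m x x + m y y := by
  have h1 := hm (x + y)
  have h2 := hm (x - y)
  simp only [map_add, map_sub, LinearMap.add_apply, LinearMap.sub_apply, hs y x] at h1 h2
  rw [abs_le]
  constructor <;> linarith

/-- Young's inequality for `x` and `(τ / 2) y`, giving the weights that occur in the norm. -/
lemma abs_two_mul_form_le_weighted (m : X →ₗ[ℝ] X →ₗ[ℝ] ℝ) (hs : ∀ x y, m x y = m y x)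
    (hm : ∀ x, 0 ≤ m x x) {τ : ℝ} (hτ : 0 < τ) (x y : X) :
    |2 * m x y| ≤ 2 / τ * m x x + τ / 2 * m y y := by
  have h := abs_two_mul_form_le m hs hm x ((τ / 2) • y)
  simp only [map_smul, LinearMap.smul_apply, smul_eq_mul] at h
  have h2 : 2 * m x y = 2 / τ * (2 * (τ / 2 * m x y)) := by field_simp
  have h3 : 2 / τ * m x x + τ / 2 * m y y =
      2 / τ * (m x x + τ / 2 * (τ / 2 * m y y)) := by field_simp
  rw [h2, h3, abs_mul, abs_of_pos (by positivity : 0 < 2 / τ)]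
  gcongr

/-- The operator of the mixed problem. -/
noncomputable def mixedOperator (τ c : ℝ) (curl : Y →ₗ[ℝ] X) (grad : Z →ₗ[ℝ] Y)
    (m : X →ₗ[ℝ] X →ₗ[ℝ] ℝ) (e t : Y →ₗ[ℝ] Y →ₗ[ℝ] ℝ) (s : Z →ₗ[ℝ] Z →ₗ[ℝ] ℝ) :
    X × Y × Z →ₗ[ℝ] Module.Dual ℝ X × Module.Dual ℝ Y × Module.Dual ℝ Z where
  toFun x := ((2 / τ) • m x.1 + m (curl x.2.1),
    (2 / τ) • e x.2.1 + e (grad x.2.2) - (m x.1).comp curl + c • t x.2.1,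
    (2 / τ) • s x.2.2 - (e x.2.1).comp grad)
  map_add' x y := by
    ext <;> simp <;> ring
  map_smul' a x := by
    ext <;> simp <;> ring

/-- The square of the norm of the mixed problem. -/
noncomputable def mixedNormSq (τ c : ℝ) (curl : Y →ₗ[ℝ] X) (grad : Z →ₗ[ℝ] Y) (div : X →ₗ[ℝ] W)
    (m : X →ₗ[ℝ] X →ₗ[ℝ] ℝ) (e t : Y →ₗ[ℝ] Y →ₗ[ℝ] ℝ) (s : Z →ₗ[ℝ] Z →ₗ[ℝ] ℝ)
    (d : W →ₗ[ℝ] W →ₗ[ℝ] ℝ) (x : X × Y × Z) : ℝ :=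
  (2 / τ * m x.1 x.1 + d (div x.1) (div x.1))
    + (2 / τ * e x.2.1 x.2.1 + τ / 2 * m (curl x.2.1) (curl x.2.1) + c * t x.2.1 x.2.1)
    + (2 / τ * s x.2.2 x.2.2 + τ / 2 * e (grad x.2.2) (grad x.2.2))

variable {τ c : ℝ} {curl : Y →ₗ[ℝ] X} {grad : Z →ₗ[ℝ] Y} {div : X →ₗ[ℝ] W}
  {m : X →ₗ[ℝ] X →ₗ[ℝ] ℝ} {e t : Y →ₗ[ℝ] Y →ₗ[ℝ] ℝ} {s : Z →ₗ[ℝ] Z →ₗ[ℝ] ℝ}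
  {d : W →ₗ[ℝ] W →ₗ[ℝ] ℝ}

/-- The couplings cancel in pairs by symmetry of `m` and `e`. -/
lemma mixedOperator_self (hms : ∀ x y, m x y = m y x) (hes : ∀ x y, e x y = e y x)
    (x : X × Y × Z) :
    (mixedOperator τ c curl grad m e t s x).1 x.1 + (mixedOperator τ c curl grad m e t s x).2.1 x.2.1
      + (mixedOperator τ c curl grad m e t s x).2.2 x.2.2 =
    2 / τ * m x.1 x.1 + 2 / τ * e x.2.1 x.2.1 + c * t x.2.1 x.2.1 + 2 / τ * s x.2.2 x.2.2 := by
  simp [mixedOperator, hms (curl x.2.1), hes (grad x.2.2)]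
  ring

lemma mixedOperator_injective (hτ : 0 < τ) (hc : 0 ≤ c)
    (hms : ∀ x y, m x y = m y x) (hm : ∀ x, 0 ≤ m x x) (hm0 : ∀ x, m x x = 0 → x = 0)
    (hes : ∀ x y, e x y = e y x) (he : ∀ x, 0 ≤ e x x) (he0 : ∀ x, e x x = 0 → x = 0)
    (hs : ∀ x, 0 ≤ s x x) (hs0 : ∀ x, s x x = 0 → x = 0) (ht : ∀ x, 0 ≤ t x x) :
    Function.Injective (mixedOperator τ c curl grad m e t s) := by
  rw [injective_iff_map_eq_zero]
  intro x hx
  have h := mixedOperator_self (τ := τ) (c := c) (curl := curl) (grad := grad) (t := t) (s := s)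
    hms hes x
  simp only [hx, Prod.fst_zero, Prod.snd_zero, LinearMap.zero_apply, add_zero] at h
  have hτ' : 0 < 2 / τ := by positivity
  have h1 := mul_nonneg hτ'.le (hm x.1)
  have h2 := mul_nonneg hτ'.le (he x.2.1)
  have h3 := mul_nonneg hτ'.le (hs x.2.2)
  have h4 := mul_nonneg hc (ht x.2.1)
  refine Prod.ext (hm0 _ ?_) (Prod.ext (he0 _ ?_) (hs0 _ ?_))
  · exact (mul_eq_zero.1 (by linarith : 2 / τ * m x.1 x.1 = 0)).resolve_left hτ'.ne'
  · exact (mul_eq_zero.1 (by linarith : 2 / τ * e x.2.1 x.2.1 = 0)).resolve_left hτ'.ne'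
  · exact (mul_eq_zero.1 (by linarith : 2 / τ * s x.2.2 x.2.2 = 0)).resolve_left hτ'.ne'

lemma mixedNormSq_nonneg (hτ : 0 < τ) (hc : 0 ≤ c) (hm : ∀ x, 0 ≤ m x x) (he : ∀ x, 0 ≤ e x x)
    (hs : ∀ x, 0 ≤ s x x) (ht : ∀ x, 0 ≤ t x x) (hd : ∀ x, 0 ≤ d x x) (x : X × Y × Z) :
    0 ≤ mixedNormSq τ c curl grad div m e t s d x := by
  have h1 := hm x.1
  have h2 := he x.2.1
  have h3 := hs x.2.2
  have h4 := mul_nonneg hc (ht x.2.1)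
  have h5 := hd (div x.1)
  have h6 := hm (curl x.2.1)
  have h7 := he (grad x.2.2)
  unfold mixedNormSq
  positivity

/-- The magnetic component of the solution is divergence free if its source is. -/
lemma mixedOperator_div_eq_zero [FiniteDimensional ℝ X] (hτ : 0 < τ)
    (hms : ∀ x y, m x y = m y x) (hm0 : ∀ x, m x x = 0 → x = 0)
    (hdc : ∀ y, div (curl y) = 0) {g : X →ₗ[ℝ] ℝ}
    (hg : ∀ C, (∀ D, div D = 0 → m C D = 0) → g C = 0) {x : X × Y × Z}
    (hx : (mixedOperator τ c curl grad m e t s x).1 = g) : div x.1 = 0 := by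
  -- The remainder `x.1 - B` is orthogonal to divergence-free fields, so as a test field it
  -- annihilates both the source and the `curl` term.
  obtain ⟨B, hB, hB'⟩ := exists_projection m hm0 (LinearMap.ker div) x.1
  have horth : ∀ D, div D = 0 → m (x.1 - B) D = 0 := fun D hD => by
    rw [map_sub, LinearMap.sub_apply, hB' D hD, sub_self]
  have h1 := LinearMap.congr_fun hx (x.1 - B)
  rw [hg _ horth] at h1
  simp only [mixedOperator, LinearMap.coe_mk, AddHom.coe_mk, LinearMap.add_apply,
    LinearMap.smul_apply, smul_eq_mul] at h1
  rw [hms (curl _), horth _ (hdc _), add_zero, mul_eq_zero] at h1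
  have h2 := h1.resolve_left (by positivity)
  have h3 : m (x.1 - B) (x.1 - B) = 0 := by
    have h4 : m (x.1 - B) (x.1 - B) = m (x.1 - B) x.1 - m (x.1 - B) B := map_sub _ _ _
    rw [h4, hms _ x.1, h2, horth B hB, sub_zero]
  rw [sub_eq_zero.1 (hm0 _ h3)]
  exact hB

/-- Continuity of the mixed form, in additive form. -/
lemma abs_mixedForm_le_add (hτ : 0 < τ) (hc : 0 ≤ c)
    (hms : ∀ x y, m x y = m y x) (hm : ∀ x, 0 ≤ m x x)
    (hes : ∀ x y, e x y = e y x) (he : ∀ x, 0 ≤ e x x)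
    (hss : ∀ x y, s x y = s y x) (hs : ∀ x, 0 ≤ s x x)
    (hts : ∀ x y, t x y = t y x) (ht : ∀ x, 0 ≤ t x x) (hd : ∀ x, 0 ≤ d x x) (x y : X × Y × Z) :
    2 * |(mixedOperator τ c curl grad m e t s x).1 y.1
      + (mixedOperator τ c curl grad m e t s x).2.1 y.2.1
      + (mixedOperator τ c curl grad m e t s x).2.2 y.2.2| ≤
    3 * (mixedNormSq τ c curl grad div m e t s d x + mixedNormSq τ c curl grad div m e t s d y) := by
  have hτ' : 0 < 2 / τ := by positivity
  have hτ'' : 0 < τ / 2 := by positivity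
  have a1 := mul_le_mul_of_nonneg_left (abs_le.1 (abs_two_mul_form_le m hms hm x.1 y.1)).1 hτ'.le
  have a2 := mul_le_mul_of_nonneg_left (abs_le.1 (abs_two_mul_form_le m hms hm x.1 y.1)).2 hτ'.le
  have b1 := abs_le.1 (abs_two_mul_form_le_weighted m hms hm hτ y.1 (curl x.2.1))
  have c1 := mul_le_mul_of_nonneg_left
    (abs_le.1 (abs_two_mul_form_le e hes he x.2.1 y.2.1)).1 hτ'.le
  have c2 := mul_le_mul_of_nonneg_left
    (abs_le.1 (abs_two_mul_form_le e hes he x.2.1 y.2.1)).2 hτ'.le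
  have d1 := abs_le.1 (abs_two_mul_form_le_weighted e hes he hτ y.2.1 (grad x.2.2))
  have e1 := abs_le.1 (abs_two_mul_form_le_weighted m hms hm hτ x.1 (curl y.2.1))
  have f1 := mul_le_mul_of_nonneg_left (abs_le.1 (abs_two_mul_form_le t hts ht x.2.1 y.2.1)).1 hc
  have f2 := mul_le_mul_of_nonneg_left (abs_le.1 (abs_two_mul_form_le t hts ht x.2.1 y.2.1)).2 hc
  have g1 := mul_le_mul_of_nonneg_left
    (abs_le.1 (abs_two_mul_form_le s hss hs x.2.2 y.2.2)).1 hτ'.le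
  have g2 := mul_le_mul_of_nonneg_left
    (abs_le.1 (abs_two_mul_form_le s hss hs x.2.2 y.2.2)).2 hτ'.le
  have i1 := abs_le.1 (abs_two_mul_form_le_weighted e hes he hτ x.2.1 (grad y.2.2))
  have p1 := mul_nonneg hτ'.le (hm x.1)
  have p2 := mul_nonneg hτ'.le (hm y.1)
  have p3 := mul_nonneg hτ'.le (he x.2.1)
  have p4 := mul_nonneg hτ'.le (he y.2.1)
  have p5 := mul_nonneg hτ'.le (hs x.2.2)
  have p6 := mul_nonneg hτ'.le (hs y.2.2)
  have p7 := mul_nonneg hc (ht x.2.1)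
  have p8 := mul_nonneg hc (ht y.2.1)
  have p9 := mul_nonneg hτ''.le (hm (curl x.2.1))
  have p10 := mul_nonneg hτ''.le (hm (curl y.2.1))
  have p11 := mul_nonneg hτ''.le (he (grad x.2.2))
  have p12 := mul_nonneg hτ''.le (he (grad y.2.2))
  have p13 := hd (div x.1)
  have p14 := hd (div y.1)
  simp only [mixedOperator, mixedNormSq, LinearMap.coe_mk, AddHom.coe_mk, LinearMap.add_apply,
    LinearMap.sub_apply, LinearMap.smul_apply, LinearMap.comp_apply, smul_eq_mul]
  rw [hms y.1 (curl x.2.1)] at b1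
  rw [hes y.2.1 (grad x.2.2)] at d1
  rw [← abs_two, ← abs_mul, abs_le, abs_two]
  -- Each term of the two norms is used at most twice: once in a diagonal product and once in a
  -- coupling. The factor 3 leaves slack.
  constructor <;> linarith [b1.1, b1.2, d1.1, d1.2, e1.1, e1.2, i1.1, i1.2]

/-- Continuity of the mixed form. -/
lemma abs_mixedForm_le (hτ : 0 < τ) (hc : 0 ≤ c)
    (hms : ∀ x y, m x y = m y x) (hm : ∀ x, 0 ≤ m x x)
    (hes : ∀ x y, e x y = e y x) (he : ∀ x, 0 ≤ e x x)
    (hss : ∀ x y, s x y = s y x) (hs : ∀ x, 0 ≤ s x x)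
    (hts : ∀ x y, t x y = t y x) (ht : ∀ x, 0 ≤ t x x) (hd : ∀ x, 0 ≤ d x x) (x y : X × Y × Z) :
    |(mixedOperator τ c curl grad m e t s x).1 y.1
      + (mixedOperator τ c curl grad m e t s x).2.1 y.2.1
      + (mixedOperator τ c curl grad m e t s x).2.2 y.2.2| ≤
    3 * √(mixedNormSq τ c curl grad div m e t s d x) *
      √(mixedNormSq τ c curl grad div m e t s d y) := by
  have hN := mixedNormSq_nonneg (curl := curl) (grad := grad) (div := div) hτ hc hm he hs ht hd
  set A := (mixedOperator τ c curl grad m e t s x).1 y.1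
    + (mixedOperator τ c curl grad m e t s x).2.1 y.2.1
    + (mixedOperator τ c curl grad m e t s x).2.2 y.2.2 with hA
  have key : ∀ a : ℝ, 0 ≤ 3 * mixedNormSq τ c curl grad div m e t s d x * (a * a) + 2 * A * a
      + 3 * mixedNormSq τ c curl grad div m e t s d y := by
    -- Replacing `x` by `a • x` in the additive bound gives a quadratic in `a` that is nonnegative;
    -- its discriminant yields the product bound, also when a norm is zero.
    intro a
    have h := abs_mixedForm_le_add (curl := curl) (grad := grad) (div := div) hτ hc hms hm hes he
      hss hs hts ht hd (a • x) y
    have hNa : mixedNormSq τ c curl grad div m e t s d (a • x) =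
        a * a * mixedNormSq τ c curl grad div m e t s d x := by
      simp only [mixedNormSq, Prod.smul_fst, Prod.smul_snd, map_smul, LinearMap.smul_apply,
        smul_eq_mul]
      ring
    rw [hNa, map_smul] at h
    simp only [Prod.smul_fst, Prod.smul_snd, LinearMap.smul_apply, smul_eq_mul] at h
    rw [← mul_add, ← mul_add, ← hA] at h
    linarith [neg_abs_le (a * A)]
  have hdis := discrim_le_zero key
  rw [discrim] at hdis
  refine abs_le_of_sq_le_sq ?_ (by positivity)
  rw [mul_pow, mul_pow, Real.sq_sqrt (hN x), Real.sq_sqrt (hN y)]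
  linarith

/-- Stability of the mixed problem. -/
lemma mixedNormSq_le (hτ : 0 < τ) (hc : 0 ≤ c)
    (hms : ∀ x y, m x y = m y x) (hm : ∀ x, 0 ≤ m x x)
    (hes : ∀ x y, e x y = e y x) (he : ∀ x, 0 ≤ e x x) (hs : ∀ x, 0 ≤ s x x)
    (hts : ∀ x y, t x y = t y x) (ht : ∀ x, 0 ≤ t x x) (hd : ∀ x, 0 ≤ d x x)
    (hdc : ∀ y, div (curl y) = 0) (hcg : ∀ z, curl (grad z) = 0)
    (htg : ∀ y z, t y (grad z) = 0) {x : X × Y × Z} (hx : div x.1 = 0) {M : ℝ} (hM : 0 ≤ M)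
    (h : ∀ y : X × Y × Z, |(mixedOperator τ c curl grad m e t s x).1 y.1
      + (mixedOperator τ c curl grad m e t s x).2.1 y.2.1
      + (mixedOperator τ c curl grad m e t s x).2.2 y.2.2| ≤
      M * √(mixedNormSq τ c curl grad div m e t s d y)) :
    √(mixedNormSq τ c curl grad div m e t s d x) ≤ 4 * M := by
  have hN := mixedNormSq_nonneg (curl := curl) (grad := grad) (div := div) hτ hc hm he hs ht hd
  have hτ' : 0 < 2 / τ := by positivity
  have hτ'' : 0 < τ / 2 := by positivity
  -- The corrections produce `(τ/2) ‖curl E‖²` and `(τ/2) ‖grad p‖²`; the cross terms that remain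
  -- cost at most half of the norm.
  set y : X × Y × Z := (x.1 + (τ / 2) • curl x.2.1, x.2.1 + (τ / 2) • grad x.2.2, x.2.2) with hy
  have p1 := mul_nonneg hτ'.le (hm x.1)
  have p3 := mul_nonneg hτ'.le (he x.2.1)
  have p5 := mul_nonneg hτ'.le (hs x.2.2)
  have p7 := mul_nonneg hc (ht x.2.1)
  have p9 := mul_nonneg hτ''.le (hm (curl x.2.1))
  have p11 := mul_nonneg hτ''.le (he (grad x.2.2))
  have q1 := abs_le.1 (abs_two_mul_form_le_weighted m hms hm hτ x.1 (curl x.2.1))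
  have q2 := abs_le.1 (abs_two_mul_form_le_weighted e hes he hτ x.2.1 (grad x.2.2))
  have hcoef (a : ℝ) : 2 / τ * (τ / 2 * a) = a := by field_simp
  have hcoef' (a : ℝ) : τ / 2 * (2 / τ * a) = a := by field_simp
  have hA : mixedNormSq τ c curl grad div m e t s d x ≤
      2 * ((mixedOperator τ c curl grad m e t s x).1 y.1
      + (mixedOperator τ c curl grad m e t s x).2.1 y.2.1
      + (mixedOperator τ c curl grad m e t s x).2.2 y.2.2) := by
    simp only [hy, mixedOperator, mixedNormSq, LinearMap.coe_mk, AddHom.coe_mk,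
      LinearMap.add_apply, LinearMap.sub_apply, LinearMap.smul_apply, LinearMap.comp_apply,
      smul_eq_mul, hx, map_zero, map_add, map_smul, hcg, htg, hms (curl x.2.1) x.1,
      hes (grad x.2.2) x.2.1, mul_add, mul_sub, hcoef']
    linarith [q1.1, q2.1]
  have hB : mixedNormSq τ c curl grad div m e t s d y ≤
      3 * mixedNormSq τ c curl grad div m e t s d x := by
    simp only [hy, mixedNormSq, LinearMap.add_apply, LinearMap.smul_apply, smul_eq_mul, hx, hdc,
      map_zero, map_add, map_smul, hcg, htg, hts (grad x.2.2) x.2.1, hms (curl x.2.1) x.1,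
      hes (grad x.2.2) x.2.1, mul_add, hcoef, add_zero, mul_zero, smul_zero]
    linarith [q1.2, q2.2]
  have h1 := (le_abs_self _).trans (h y)
  -- The factor `√3` is rounded up to 2, so `‖x‖² ≤ 2 M ‖y‖ ≤ 4 M ‖x‖`.
  have h2 : √(mixedNormSq τ c curl grad div m e t s d y) ≤
      2 * √(mixedNormSq τ c curl grad div m e t s d x) := by
    rw [Real.sqrt_le_left (by positivity), mul_pow, Real.sq_sqrt (hN x)]
    linarith [hN x]
  have h3 := mul_le_mul_of_nonneg_left h2 hM
  have h4 := Real.sq_sqrt (hN x)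
  rcases (Real.sqrt_nonneg (mixedNormSq τ c curl grad div m e t s d x)).eq_or_lt with h0 | h0
  · rw [← h0]; positivity
  · refine le_of_mul_le_mul_right ?_ h0
    linarith

/-- Well-posedness of the abstract mixed problem. -/
theorem mixedProblem_wellPosed [FiniteDimensional ℝ X] [FiniteDimensional ℝ Y]
    [FiniteDimensional ℝ Z] (hτ : 0 < τ) (hc : 0 ≤ c)
    (hms : ∀ x y, m x y = m y x) (hm : ∀ x, 0 ≤ m x x) (hm0 : ∀ x, m x x = 0 → x = 0)
    (hes : ∀ x y, e x y = e y x) (he : ∀ x, 0 ≤ e x x) (he0 : ∀ x, e x x = 0 → x = 0)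
    (hss : ∀ x y, s x y = s y x) (hs : ∀ x, 0 ≤ s x x) (hs0 : ∀ x, s x x = 0 → x = 0)
    (hts : ∀ x y, t x y = t y x) (ht : ∀ x, 0 ≤ t x x) (hd : ∀ x, 0 ≤ d x x)
    (hdc : ∀ y, div (curl y) = 0) (hcg : ∀ z, curl (grad z) = 0)
    (htg : ∀ y z, t y (grad z) = 0)
    (gX : X →ₗ[ℝ] ℝ) (gY : Y →ₗ[ℝ] ℝ) (gZ : Z →ₗ[ℝ] ℝ)
    (hg : ∀ C, (∀ D, div D = 0 → m C D = 0) → gX C = 0) :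
    ∃ x : X × Y × Z, mixedOperator τ c curl grad m e t s x = (gX, gY, gZ) ∧
      (∀ y, mixedOperator τ c curl grad m e t s y = (gX, gY, gZ) → y = x) ∧ div x.1 = 0 ∧
      √(mixedNormSq τ c curl grad div m e t s d x) ≤ 4 * sInf {M : ℝ | 0 ≤ M ∧
        ∀ y : X × Y × Z, |gX y.1 + gY y.2.1 + gZ y.2.2| ≤
          M * √(mixedNormSq τ c curl grad div m e t s d y)} ∧
      sInf {M : ℝ | 0 ≤ M ∧ ∀ y : X × Y × Z, |gX y.1 + gY y.2.1 + gZ y.2.2| ≤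
          M * √(mixedNormSq τ c curl grad div m e t s d y)} ≤
        3 * √(mixedNormSq τ c curl grad div m e t s d x) := by
  have hinj := mixedOperator_injective (curl := curl) (grad := grad) hτ hc hms hm hm0 hes he he0
    hs hs0 ht
  obtain ⟨x, hx⟩ := (LinearMap.injective_iff_surjective_of_finrank_eq_finrank
    (by simp [Module.finrank_prod, Subspace.dual_finrank_eq])).1 hinj (gX, gY, gZ)
  have hdiv := mixedOperator_div_eq_zero hτ hms hm0 hdc hg (congrArg Prod.fst hx)
  have hcont := abs_mixedForm_le (curl := curl) (grad := grad) (div := div) hτ hc hms hm hes he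
    hss hs hts ht hd x
  have hstab := fun M => mixedNormSq_le (M := M) hτ hc hms hm hes he hs hts ht hd hdc hcg htg hdiv
  rw [hx] at hcont hstab
  refine ⟨x, hx, fun y hy => hinj (hy.trans hx.symm), hdiv, ?_,
    csInf_le ⟨0, fun M hM => hM.1⟩ ⟨by positivity, hcont⟩⟩
  rw [← div_le_iff₀' (by norm_num)]
  -- Continuity of the form at the solution shows that the set defining the dual norm is nonempty.
  refine le_csInf ⟨_, by positivity, hcont⟩ fun M hM => ?_
  rw [div_le_iff₀' (by norm_num)]
  exact hstab M hM.1 hM.2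

end Abstract

end MaxwellFEM

/-! ### Application to the finite element spaces -/

open MaxwellFEM

theorem theorem3p2 (T : MaxwellFEM.Mesh) (r : ℕ) (τ γ : ℝ) (ε μ : MaxwellFEM.E3 → ℝ)
    (hτ : 0 < τ) (hγ : 0 ≤ 1 + γ)
    (hε : ContinuousOn ε T.domain) (hε_pos : ∀ x ∈ T.domain, 0 < ε x)
    (hε_int : MeasureTheory.IntegrableOn ε T.domain)
    (hμ : ContinuousOn μ T.domain) (hμ_pos : ∀ x ∈ T.domain, 0 < μ x)
    (hμ_int : MeasureTheory.IntegrableOn (fun x => (μ x)⁻¹) T.domain)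
    (gB : MaxwellFEM.raviartThomas T r →ₗ[ℝ] ℝ) (gE : MaxwellFEM.nedelec T r →ₗ[ℝ] ℝ)
    (gp : MaxwellFEM.lagrange T r →ₗ[ℝ] ℝ)
    (hgB : MaxwellFEM.InDivFreeDual μ gB) :
    ∃ x : MaxwellFEM.Vh T r,
      MaxwellFEM.IsSolution τ γ ε μ gB gE gp x ∧
      (∀ y : MaxwellFEM.Vh T r, MaxwellFEM.IsSolution τ γ ε μ gB gE gp y → y = x) ∧
      MaxwellFEM.divh x.1.1 = 0 ∧
      MaxwellFEM.normVh τ γ ε μ x ≤ 4 * MaxwellFEM.dualNorm τ γ ε μ gB gE gp ∧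
      MaxwellFEM.dualNorm τ γ ε μ gB gE gp ≤ 3 * MaxwellFEM.normVh τ γ ε μ x := by
  have hwε : IsWeight T ε := ⟨hε_pos, hε_int⟩
  have hwμ : IsWeight T (fun x => (μ x)⁻¹) := ⟨fun x hx => inv_pos.2 (hμ_pos x hx), hμ_int⟩
  -- The forms are restricted to the discrete spaces; only `d` stays on all piecewise polynomials,
  -- where divergences live.
  obtain ⟨x, hx, huniq, hdiv, hle, hge⟩ := mixedProblem_wellPosed (τ := τ) (c := 1 + γ)
    (curl := curlMap T r) (grad := gradMap T r) (div := divMap T r)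
    (m := hwμ.form.compl₁₂ (raviartThomas T r).subtype (raviartThomas T r).subtype)
    (e := hwε.form.compl₁₂ (nedelec T r).subtype (nedelec T r).subtype)
    (t := (gammaForm T).compl₁₂ (nedelec T r).subtype (nedelec T r).subtype)
    (s := (scalarForm T).compl₁₂ (lagrange T r).subtype (lagrange T r).subtype)
    (d := scalarForm T) hτ hγ
    (fun u v => innerV_comm _ u.1 v.1) (fun u => hwμ.innerV_self_nonneg u.1)
    (fun u h => Subtype.ext (hwμ.innerV_self_eq_zero h))
    (fun u v => innerV_comm _ u.1 v.1) (fun u => hwε.innerV_self_nonneg u.1)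
    (fun u h => Subtype.ext (hwε.innerV_self_eq_zero h))
    (fun p q => innerS_comm p.1 q.1) (fun p => innerS_self_nonneg p.1)
    (fun p h => Subtype.ext (innerS_self_eq_zero h))
    (fun u v => innerGamma_comm u.1 v.1) (fun u => innerGamma_self_nonneg u.1)
    (fun p => innerS_self_nonneg p)
    (fun v => funext fun _ => divP_curlP _) (fun p => Subtype.ext (funext fun _ => curlP_gradP _))
    (fun u p => innerGamma_gradh_eq_zero u.1 p.2) gB gE gp hgB
  refine ⟨x, ?_, fun y hy => huniq y ?_, hdiv, hle, hge⟩
  · exact ⟨fun C => LinearMap.congr_fun (congrArg Prod.fst hx) C,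
      fun F => LinearMap.congr_fun (congrArg (fun z => z.2.1) hx) F,
      fun q => LinearMap.congr_fun (congrArg (fun z => z.2.2) hx) q⟩
  · exact Prod.ext (LinearMap.ext hy.1) (Prod.ext (LinearMap.ext hy.2.1) (LinearMap.ext hy.2.2))
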